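/- Let $d,T\in\mathbb N$, $r\ge 0$, $\sigma>0$. In the linear-Gaussian bandit, $\theta\sim N(0,\Sigma_0)$ in $\mathbb R^d$; at times $t=0,1,2,\dots$ a player picks an action $A_t$ in the ball $\{a\in\mathbb R^d:\|a\|_2\le r\}$ and receives $R_{t+1}=\theta^\top A_t+W_{t+1}$ with $W_{t+1}$ i.i.d. $N(0,\sigma^2)$, independent of $\theta$ and of the player's randomization. A policy $\pi$ maps each history $H_t=(A_0,R_1,\dots,A_{t-1},R_t)$ (measurably) to a probability distribution on the ball, from which $A_t$ is drawn given $(\theta,H_t)$. With $A_*\in\arg\max_{\|a\|_2\le r}\theta^\top a$, the Bayesian regret of $\pi$ is $\mathrm{Reg}^\pi(T)=\sum_{t=0}^{T-1}\mathbb E[\theta^\top A_*-R_{t+1}]$. Corollary (polynomially scaling eigenvalues). For every $\alpha\ge 0$ there is a constant $c>0$, depending only on $\alpha$, such that the following holds for all $d$, $r\ge0$, $\sigma>0$, all positive semidefinite $\Sigma_0$ whose eigenvalues $\tau_1^2\ge\dots\ge\tau_d^2$ scale polynomially, and all $T\ge d$. Here polynomial scaling means that $\tau_{d-i}^2=(i+s)^{2\alpha}$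 for $i=0,\dots,d-1$, where either $s=0$ or $s=1$ (so the eigenvalues are $0^{2\alpha},\dots,(d-1)^{2\alpha}$ or $1^{2\alpha},\dots,d^{2\alpha}$, with $0^0=1$). For every policy $\pi$ the regret is well defined (each $\theta^\top A_*-R_{t+1}$, $t<T$, is integrable) and $$\mathrm{Reg}^\pi(T)\;\ge\; c\,\frac{r}{\sqrt{\operatorname{tr}\Sigma_0}}\,d\,\operatorname{tr}(\Sigma_0)\;=\;c\,r\,d\,\sqrt{\operatorname{tr}(\Sigma_0)}$$ (if $\operatorname{tr}\Sigma_0=0$, the middle expression is read as $0$). The right-hand side is, up to the constant $c$, the burn-in term $d\,r\sqrt{\operatorname{tr}(\Sigma_0)}$ of the upper bound $\tilde O(\sigma d\sqrt T+d\,r\sqrt{\operatorname{tr}(\Sigma_0)})$ for Thompson sampling. -/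

import Mathlib

open MeasureTheory ProbabilityTheory
open scoped NNReal

noncomputable section

namespace LinearGaussianBandit

/-- The parameter and action space `ℝ^d` with its Euclidean structure. -/
abbrev Vec (d : ℕ) : Type := EuclideanSpace ℝ (Fin d)

/-- A history `H_t = (A_0, R_1, …, A_{t-1}, R_t)`: the entry at `s < t` is the pair
`(A_s, R_{s+1})`. -/
abbrev History (d t : ℕ) : Type := Fin t → Vec d × ℝ

/-- The action set: the closed Euclidean ball of radius `r` around the origin. -/
def actionSet (d : ℕ) (r : ℝ) : Set (Vec d) := {a | ‖a‖ ≤ r}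

/-- A (randomized, history-dependent) policy: for every time `t` a (measurable) map from histories
`H_t` to probability distributions on the action set. -/
structure Policy (d : ℕ) (r : ℝ) where
  act : (t : ℕ) → Kernel (History d t) (Vec d)
  isMarkov : ∀ t, IsMarkovKernel (act t)
  mem_actionSet : ∀ t h, ∀ᵐ a ∂(act t h), a ∈ actionSet d r

instance {d : ℕ} {r : ℝ} (π : Policy d r) (t : ℕ) : IsMarkovKernel (π.act t) := π.isMarkov t

/-- `H_{t+1}` from `H_t`, the action `A_t = a` and the reward `R_{t+1} = ρ`. -/
def extend {d t : ℕ} (h : History d t) (a : Vec d) (ρ : ℝ) : History d (t + 1) :=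
  Fin.snoc (α := fun _ => Vec d × ℝ) h (a, ρ)

/-- The parameter and the next history `(θ, H_{t+1})`, as a function of `((θ, H_t), A_t)` and of
the noise `W_{t+1}`, with the reward `R_{t+1} = θᵀ A_t + W_{t+1}`. -/
def step (d t : ℕ) (x : ((Vec d × History d t) × Vec d) × ℝ) : Vec d × History d (t + 1) :=
  (x.1.1.1, extend x.1.1.2 x.1.2 (inner ℝ x.1.1.1 x.1.2 + x.2))

/-- The joint law of `(θ, H_t)` when `θ` is drawn from `prior` and the player follows `π`.
Given `(θ, H_t)`, the action `A_t` is drawn from `π(H_t)`, then `W_{t+1} ∼ N(0, σ²)`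
independently of everything before. -/
def law {d : ℕ} {r : ℝ} (prior : Measure (Vec d)) (σ : ℝ≥0) (π : Policy d r) :
    (t : ℕ) → Measure (Vec d × History d t)
  | 0 => prior.map (fun θ => (θ, (Fin.elim0 : History d 0)))
  | t + 1 =>
      (((law prior σ π t) ⊗ₘ ((π.act t).comap Prod.snd measurable_snd)).prod
        (gaussianReal 0 (σ ^ 2))).map (step d t)

/-- `aStar θ` maximizes `a ↦ θᵀ a` over the action set, for every `θ`. -/
def IsOptimalAction {d : ℕ} (r : ℝ) (aStar : Vec d → Vec d) : Prop :=
  ∀ θ, aStar θ ∈ actionSet d r ∧ ∀ a ∈ actionSet d r, inner ℝ θ a ≤ inner ℝ θ (aStar θ)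

/-- The instantaneous regret `θᵀ A_* - R_{t+1}` as a function of `(θ, H_{t+1})`. -/
def instRegret {d : ℕ} (aStar : Vec d → Vec d) (t : ℕ) (x : Vec d × History d (t + 1)) : ℝ :=
  inner ℝ x.1 (aStar x.1) - (x.2 (Fin.last t)).2

/-- The Bayesian regret `∑_{t<T} E[θᵀ A_* - R_{t+1}]` of the policy `π`. -/
def bayesRegret {d : ℕ} {r : ℝ} (prior : Measure (Vec d)) (σ : ℝ≥0) (aStar : Vec d → Vec d)
    (π : Policy d r) (T : ℕ) : ℝ :=
  ∑ t ∈ Finset.range T, ∫ x, instRegret aStar t x ∂(law prior σ π (t + 1))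

/-- Polynomially scaling eigenvalues: with the eigenvalues `τ_1² ≥ ⋯ ≥ τ_d²` of `S` in decreasing
order, `τ_{d-i}² = (i + s)^{2α}` for `i = 0, …, d-1`, where `s = 0` (eigenvalues
`0^{2α}, …, (d-1)^{2α}`) or `s = 1` (eigenvalues `1^{2α}, …, d^{2α}`).
Here `eigenvalues₀` is the decreasing enumeration with indices from `0`, so that `τ_{d-i}²` is its
entry at `d - 1 - i = i.rev`. -/
def PolynomialEigenvalues {d : ℕ} {S : Matrix (Fin d) (Fin d) ℝ} (hS : S.IsHermitian)
    (α : ℝ) (s : ℕ) : Prop :=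
  ∀ i : Fin (Fintype.card (Fin d)), hS.eigenvalues₀ i.rev = (((i : ℕ) + s : ℕ) : ℝ) ^ (2 * α)

lemma measurable_step (d t : ℕ) : Measurable (step d t) := by
  unfold step extend
  refine Measurable.prodMk (by fun_prop) (measurable_pi_iff.2 fun i => ?_)
  refine Fin.lastCases ?_ (fun j => ?_) i
  · simp only [Fin.snoc_last]
    fun_prop
  · simp only [Fin.snoc_castSucc]
    fun_prop

/-- The recursion does define a probability law. -/
instance {d : ℕ} {r : ℝ} (prior : Measure (Vec d)) [IsProbabilityMeasure prior] (σ : ℝ≥0)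
    (π : Policy d r) (t : ℕ) : IsProbabilityMeasure (law prior σ π t) := by
  induction t with
  | zero =>
    exact Measure.isProbabilityMeasure_map (by fun_prop)
  | succ t ih =>
    exact Measure.isProbabilityMeasure_map (measurable_step d t).aemeasurable

end LinearGaussianBandit

end

/-! Since the optimal action earns `r * ‖θ‖`, the expected regret of round `t` is `r E‖θ‖ - E⟪θ,
A_t⟫`. Given the history, `θ` is Gaussian with some mean `m`, and the action depends on `θ` only
through the history, so `E⟪θ, A_t⟫ ≤ r E‖m‖`. One scalar observation raises `E‖m‖²` by at most the
squared norm of the square root of the current covariance, whatever the noise level. That norm never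
increases, so `E‖m‖ ≤ √(t L)` with `L` a bound on the prior eigenvalues, while `E‖θ‖ ≥ κ √(tr Σ₀)`
with `κ = absMean`. Polynomial scaling makes the trace comparable to `d L`, so each of the first `⌈ε
d⌉` rounds costs at least `r (κ/2) √(tr Σ₀)`. Later rounds cost at least zero.

Conditional laws are replaced by a representation (`IsFilterLaw`): the pair `(θ, H_t)` is
distributed as `(m + B z, h)`, where `z` is standard Gaussian and independent of `(h, m, B)`.
`IsFilterLaw.succ` propagates it by a square-root Kalman update, which rests on
`map_stdGaussian_observation`. The two sides of the estimate are `absMean_mul_sqrt_trace_le` and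
`integral_inner_action_le`; they meet in `le_integral_instRegret`. -/

noncomputable section

namespace LinearGaussianBandit

/-! ### Conditioning a standard Gaussian vector on one noisy linear observation -/

/-- The standard deviation of `⟪b, z⟫ + w` for a standard Gaussian vector `z` and independent noise
`w` with standard deviation `σ`. -/
def rewardStd {d : ℕ} (σ : ℝ≥0) (b : Vec d) : ℝ := √(‖b‖ ^ 2 + (σ : ℝ) ^ 2)

/-- The square root of the covariance of a standard Gaussian vector `z` given `⟪b, z⟫ + w`. -/
def shrink {d : ℕ} (σ : ℝ≥0) (b : Vec d) : Vec d →L[ℝ] Vec d :=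
  ContinuousLinearMap.id ℝ (Vec d) -
    (1 / (rewardStd σ b * (rewardStd σ b + σ))) • (innerSL ℝ b).smulRight b

variable {d : ℕ} {σ : ℝ≥0}

lemma shrink_apply (b z : Vec d) : shrink σ b z =
    z - (1 / (rewardStd σ b * (rewardStd σ b + σ))) • (inner ℝ b z : ℝ) • b := by
  simp [shrink]

lemma sq_rewardStd (b : Vec d) : rewardStd σ b ^ 2 = ‖b‖ ^ 2 + (σ : ℝ) ^ 2 :=
  Real.sq_sqrt (by positivity)

lemma rewardStd_pos (hσ : 0 < σ) (b : Vec d) : 0 < rewardStd σ b :=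
  Real.sqrt_pos.2 (by positivity)

lemma shrink_symm (b x y : Vec d) : inner ℝ (shrink σ b x) y = inner ℝ x (shrink σ b y) := by
  simp only [shrink_apply, inner_sub_left, inner_sub_right, inner_smul_left, inner_smul_right,
    real_inner_comm b, conj_trivial]
  ring

/-- With `ρ = rewardStd σ b`, the coefficient is chosen so that `shrink σ b` fixes the orthogonal
complement of `b` and scales `b` by `σ / ρ`. Its square is therefore the posterior covariance `1 - b
bᵀ / ρ²`. -/
lemma norm_sq_shrink (hσ : 0 < σ) (b x : Vec d) :
    ‖shrink σ b x‖ ^ 2 = ‖x‖ ^ 2 - (inner ℝ b x / rewardStd σ b) ^ 2 := by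
  have hρ := rewardStd_pos hσ b
  have hσ' : (0 : ℝ) < σ := hσ
  have hb : ‖b‖ ^ 2 = rewardStd σ b ^ 2 - (σ : ℝ) ^ 2 := by rw [sq_rewardStd]; ring
  rw [shrink_apply, norm_sub_sq_real, norm_smul, norm_smul, inner_smul_right, inner_smul_right,
    mul_pow, mul_pow, hb, Real.norm_eq_abs, Real.norm_eq_abs, sq_abs, sq_abs, real_inner_comm]
  field_simp
  ring

lemma norm_shrink_le (hσ : 0 < σ) (b : Vec d) : ‖shrink σ b‖ ≤ 1 := by
  refine ContinuousLinearMap.opNorm_le_bound _ zero_le_one fun x => ?_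
  rw [one_mul]
  refine le_of_sq_le_sq ?_ (norm_nonneg _)
  rw [norm_sq_shrink hσ]
  nlinarith [sq_nonneg (inner ℝ b x / rewardStd σ b)]

/-- The joint law of a standard Gaussian vector and a noisy linear observation of it, expressed
through the observation and an independent standard Gaussian vector. -/
lemma map_stdGaussian_observation (hσ : 0 < σ) (b : Vec d) :
    ((stdGaussian (Vec d)).prod (gaussianReal 0 (σ ^ 2))).map
        (fun p => (p.1, inner ℝ b p.1 + p.2)) =
      ((stdGaussian (Vec d)).prod (gaussianReal 0 1)).map
        (fun p => ((p.2 / rewardStd σ b) • b + shrink σ b p.1, rewardStd σ b * p.2)) := by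
  have hρ := rewardStd_pos hσ b
  have : IsProbabilityMeasure (((stdGaussian (Vec d)).prod (gaussianReal 0 (σ ^ 2))).map
        (fun p => (p.1, inner ℝ b p.1 + p.2))) :=
    Measure.isProbabilityMeasure_map (by fun_prop)
  have : IsProbabilityMeasure (((stdGaussian (Vec d)).prod (gaussianReal 0 1)).map
        (fun p => ((p.2 / rewardStd σ b) • b + shrink σ b p.1, rewardStd σ b * p.2))) :=
    Measure.isProbabilityMeasure_map (by fun_prop)
  refine Measure.ext_of_charFunDual ?_
  ext L
  obtain ⟨u, hu⟩ : ∃ u : Vec d, ∀ x : Vec d, L (x, 0) = inner ℝ u x :=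
    ⟨(InnerProductSpace.toDual ℝ (Vec d)).symm (L.comp (ContinuousLinearMap.inl ℝ _ _)),
      fun x => by simp⟩
  set s : ℝ := L (0, 1)
  have hL : ∀ x y, L (x, y) = inner ℝ u x + y * s := by
    intro x y
    have : ((x, y) : Vec d × ℝ) = (x, 0) + y • (0, 1) := by simp
    rw [this, map_add, map_smul, hu, smul_eq_mul]
  have key : ∀ (v : Vec d) (q : ℝ) (τ : ℝ≥0),
      ∫ p : Vec d × ℝ, Complex.exp ((inner ℝ p.1 v + p.2 * q : ℝ) * Complex.I)
        ∂((stdGaussian (Vec d)).prod (gaussianReal 0 τ)) =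
      Complex.exp (-((‖v‖ ^ 2 + τ * q ^ 2 : ℝ) : ℂ) / 2) := by
    intro v q τ
    have h1 := charFun_stdGaussian v
    have h2 := charFun_gaussianReal (μ := 0) (v := τ) q
    rw [charFun_apply] at h1
    rw [charFun_apply_real] at h2
    have : ∀ p : Vec d × ℝ, Complex.exp ((inner ℝ p.1 v + p.2 * q : ℝ) * Complex.I) =
        Complex.exp ((inner ℝ p.1 v : ℝ) * Complex.I) * Complex.exp (q * p.2 * Complex.I) := by
      intro p
      rw [← Complex.exp_add]
      push_cast
      ring_nf
    simp_rw [this]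
    rw [integral_prod_mul (fun x : Vec d => Complex.exp ((inner ℝ x v : ℝ) * Complex.I))
      (fun y : ℝ => Complex.exp (q * y * Complex.I)), h1, h2, ← Complex.exp_add]
    push_cast
    ring_nf
  rw [charFunDual_apply, charFunDual_apply, integral_map (by fun_prop) (by fun_prop),
    integral_map (by fun_prop) (by fun_prop)]
  have e1 : ∀ p : Vec d × ℝ, L (p.1, inner ℝ b p.1 + p.2) = inner ℝ p.1 (u + s • b) + p.2 * s := by
    intro p
    rw [hL, inner_add_right, inner_smul_right, real_inner_comm u, real_inner_comm b]
    ring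
  have e2 : ∀ p : Vec d × ℝ, L ((p.2 / rewardStd σ b) • b + shrink σ b p.1, rewardStd σ b * p.2) =
      inner ℝ p.1 (shrink σ b u) + p.2 * (inner ℝ b u / rewardStd σ b + rewardStd σ b * s) := by
    intro p
    rw [hL, inner_add_right, inner_smul_right, ← shrink_symm, real_inner_comm u b,
      real_inner_comm (shrink σ b u)]
    ring
  simp_rw [e1, e2]
  rw [key, key, norm_sq_shrink hσ, norm_add_sq_real, norm_smul, inner_smul_right,
    real_inner_comm u b, mul_pow, Real.norm_eq_abs, sq_abs]
  -- Completing the square: as `ρ² = ‖b‖² + σ²`, both exponents come from the quadratic form `‖u‖² +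
  -- 2 s ⟪b, u⟫ + ρ² s²`.
  congr 4
  rw [NNReal.coe_pow, NNReal.coe_one]
  have h := sq_rewardStd (σ := σ) b
  have h' : inner ℝ u b / rewardStd σ b * rewardStd σ b = inner ℝ u b := by field_simp
  linear_combination (-s ^ 2) * h - 2 * s * h'

lemma lintegral_stdGaussian_observation (hσ : 0 < σ) (b : Vec d) {f : Vec d × ℝ → ENNReal}
    (hf : Measurable f) :
    ∫⁻ z, ∫⁻ w, f (z, inner ℝ b z + w) ∂(gaussianReal 0 (σ ^ 2)) ∂(stdGaussian (Vec d)) =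
      ∫⁻ ξ, ∫⁻ z, f ((ξ / rewardStd σ b) • b + shrink σ b z, rewardStd σ b * ξ)
        ∂(stdGaussian (Vec d)) ∂(gaussianReal 0 1) := by
  have h := congrArg (fun μ => ∫⁻ p, f p ∂μ) (map_stdGaussian_observation hσ b)
  simp only at h
  rw [lintegral_map hf (by fun_prop), lintegral_map hf (by fun_prop),
    lintegral_prod _ (by fun_prop), lintegral_prod_symm _ (by fun_prop)] at h
  exact h

/-! ### Gaussian moments and the square root of the prior covariance -/

lemma lintegral_norm_add_smul_sq (m v : Vec d) :
    ∫⁻ ξ, ENNReal.ofReal (‖m + ξ • v‖ ^ 2) ∂(gaussianReal 0 1) =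
      ENNReal.ofReal (‖m‖ ^ 2 + ‖v‖ ^ 2) := by
  have h1 : Integrable (fun ξ : ℝ => ξ) (gaussianReal 0 1) := IsGaussian.integrable_fun_id
  have h2 : Integrable (fun ξ : ℝ => ξ ^ 2) (gaussianReal 0 1) :=
    (IsGaussian.memLp_two_id (μ := gaussianReal 0 1)).integrable_sq
  have hsq : ∫ ξ, ξ ^ 2 ∂(gaussianReal 0 1) = 1 := by
    have h := variance_fun_id_gaussianReal (μ := 0) (v := 1)
    rw [variance_eq_integral (by fun_prop)] at h
    simpa using h
  have e : ∀ ξ : ℝ, ‖m + ξ • v‖ ^ 2 = ‖m‖ ^ 2 + 2 * inner ℝ m v * ξ + ‖v‖ ^ 2 * ξ ^ 2 := by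
    intro ξ
    rw [norm_add_sq_real, norm_smul, inner_smul_right, mul_pow, Real.norm_eq_abs, sq_abs]
    ring
  have hi : Integrable (fun ξ : ℝ => ‖m‖ ^ 2 + 2 * inner ℝ m v * ξ + ‖v‖ ^ 2 * ξ ^ 2)
      (gaussianReal 0 1) := ((integrable_const _).add (h1.const_mul _)).add (h2.const_mul _)
  rw [← ofReal_integral_eq_lintegral_ofReal (by simpa only [e] using hi)
    (ae_of_all _ fun _ => sq_nonneg _)]
  simp_rw [e]
  have a1 : Integrable (fun ξ : ℝ => ‖m‖ ^ 2 + 2 * inner ℝ m v * ξ) (gaussianReal 0 1) :=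
    (integrable_const _).add (h1.const_mul _)
  rw [integral_add a1 (h2.const_mul _),
    integral_add (integrable_const _) (h1.const_mul _), integral_const_mul, integral_const_mul, hsq]
  simp

/-- The mean of the absolute value of a standard normal variable. -/
def absMean : ℝ := ∫ ξ, |ξ| ∂(gaussianReal 0 1)

lemma absMean_pos : 0 < absMean := by
  have h1 : Integrable (fun ξ : ℝ => |ξ|) (gaussianReal 0 1) :=
    IsGaussian.integrable_fun_id.abs
  refine (integral_pos_iff_support_of_nonneg (fun _ => abs_nonneg _) h1).2 ?_
  have : Function.support (fun ξ : ℝ => |ξ|) = {0}ᶜ := by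
    ext x; simp
  have : NullSingletonClass (gaussianReal 0 1) := nullSingletonClass_gaussianReal one_ne_zero
  rw [‹Function.support _ = _›, prob_compl_eq_one_sub (measurableSet_singleton _), measure_singleton]
  simp

lemma integral_abs_gaussianReal (v : ℝ≥0) :
    ∫ x, |x| ∂(gaussianReal 0 v) = √v * absMean := by
  have h : gaussianReal 0 v = (gaussianReal 0 1).map (√v * ·) := by
    rw [gaussianReal_map_const_mul]
    congr 1
    · simp
    · ext; simp [Real.sq_sqrt]
  rw [h, integral_map (by fun_prop) (by fun_prop), absMean, ← integral_const_mul]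
  simp [abs_mul, abs_of_nonneg (Real.sqrt_nonneg _)]

/-- Cauchy–Schwarz gives `∑ √(S i i) |θ i| ≤ √(tr S) ‖θ‖`. Each `θ i` has variance `S i i`, so the
left side has mean `absMean * tr S`; divide by `√(tr S)`. -/
lemma absMean_mul_sqrt_trace_le {S : Matrix (Fin d) (Fin d) ℝ} (hS : S.PosSemidef) :
    absMean * √S.trace ≤ ∫ θ, ‖θ‖ ∂(multivariateGaussian 0 S) := by
  have hnorm : Integrable (fun θ : Vec d => ‖θ‖) (multivariateGaussian 0 S) :=
    IsGaussian.integrable_fun_id.norm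
  have hii : ∀ i, 0 ≤ S i i := fun i => hS.diag_nonneg
  have habs : ∀ i, ∫ θ : Vec d, |θ i| ∂(multivariateGaussian 0 S) = √(S i i) * absMean := by
    intro i
    have h := measurePreserving_eval_multivariateGaussian (μ := 0) hS (i := i)
    have h2 := integral_abs_gaussianReal (S i i).toNNReal
    have h3 : (multivariateGaussian 0 S).map (fun x : Vec d => x i) =
      gaussianReal 0 (S i i).toNNReal := by simpa using h.map_eq
    rw [← h3, integral_map (by fun_prop) (by fun_prop), Real.coe_toNNReal _ (hii i)] at h2
    exact h2
  have hiabs : ∀ i, Integrable (fun θ : Vec d => |θ i|) (multivariateGaussian 0 S) := fun i =>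
    hnorm.mono (by fun_prop) (ae_of_all _ fun θ => by simpa using PiLp.norm_apply_le θ i)
  have htr : S.trace = ∑ i, S i i := rfl
  have htr0 : 0 ≤ S.trace := htr ▸ Finset.sum_nonneg fun i _ => hii i
  have h1 : √S.trace * (absMean * √S.trace) ≤
      √S.trace * ∫ θ, ‖θ‖ ∂(multivariateGaussian 0 S) := by
    calc √S.trace * (absMean * √S.trace) = ∑ i, √(S i i) * (√(S i i) * absMean) := by
          simp_rw [← mul_assoc, Real.mul_self_sqrt (hii _), ← Finset.sum_mul, ← htr]
          linear_combination absMean * Real.mul_self_sqrt htr0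
      _ = ∫ θ : Vec d, ∑ i, √(S i i) * |θ i| ∂(multivariateGaussian 0 S) := by
          rw [integral_finsetSum _ fun i _ => (hiabs i).const_mul _]
          simp_rw [integral_const_mul, habs]
      _ ≤ ∫ θ : Vec d, √S.trace * ‖θ‖ ∂(multivariateGaussian 0 S) := by
          refine integral_mono (integrable_finsetSum _ fun i _ => (hiabs i).const_mul _)
            (hnorm.const_mul _) fun θ => ?_
          refine (Real.sum_mul_le_sqrt_mul_sqrt _ _ _).trans ?_
          simp_rw [Real.sq_sqrt (hii _), EuclideanSpace.norm_eq, Real.norm_eq_abs, htr]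
          exact le_rfl
      _ = _ := integral_const_mul _ _
  -- The division is impossible when the trace vanishes, but then the left side is zero.
  rcases htr0.eq_or_lt with h0 | h0
  · rw [← h0]
    simpa using integral_nonneg fun θ : Vec d => norm_nonneg θ
  · exact le_of_mul_le_mul_left h1 (Real.sqrt_pos.2 h0)

open scoped MatrixOrder in
lemma norm_toEuclideanCLM_sqrt_le {S : Matrix (Fin d) (Fin d) ℝ} (hS : S.PosSemidef) {L : ℝ}
    (hL : ∀ i, hS.isHermitian.eigenvalues i ≤ L) (hL0 : 0 ≤ L) :
    ‖Matrix.toEuclideanCLM (n := Fin d) (𝕜 := ℝ) (CFC.sqrt S)‖ ≤ √L := by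
  set B := Matrix.toEuclideanCLM (n := Fin d) (𝕜 := ℝ) (CFC.sqrt S) with hB
  have hsa : IsSelfAdjoint B := (CFC.sqrt_nonneg S).isSelfAdjoint.map _
  have hBB : B * B = Matrix.toEuclideanCLM (n := Fin d) (𝕜 := ℝ) S := by
    rw [hB, ← map_mul, CFC.sqrt_mul_sqrt_self _ hS.nonneg]
  refine ContinuousLinearMap.opNorm_le_bound _ (Real.sqrt_nonneg _) fun x => ?_
  refine le_of_sq_le_sq ?_ (by positivity)
  have e1 : ‖B x‖ ^ 2 = inner ℝ x ((B * B) x) := by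
    rw [← real_inner_self_eq_norm_sq, mul_apply_eq_comp,
      ← ContinuousLinearMap.adjoint_inner_left B, hsa.adjoint_eq, real_inner_comm]
  set e := hS.isHermitian.eigenvectorBasis
  have e2 : ∀ j, inner ℝ (e j) ((B * B) x) =
      hS.isHermitian.eigenvalues j * inner ℝ (e j) x := by
    intro j
    have h1 : (B * B) (e j) = hS.isHermitian.eigenvalues j • e j := by
      rw [hBB]
      ext k
      simpa using congrFun (hS.isHermitian.mulVec_eigenvectorBasis j) k
    rw [mul_apply_eq_comp, ← ContinuousLinearMap.adjoint_inner_left,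
      ← ContinuousLinearMap.adjoint_inner_left, hsa.adjoint_eq, ← mul_apply_eq_comp, h1,
      inner_smul_left, conj_trivial]
  rw [e1, mul_pow, Real.sq_sqrt hL0, ← e.sum_inner_mul_inner, ← e.sum_sq_inner_right x,
    Finset.mul_sum]
  refine Finset.sum_le_sum fun j _ => ?_
  rw [e2, real_inner_comm]
  nlinarith [sq_nonneg (inner ℝ (e j) x), hL j]

/-! ### The square-root Kalman filter along the bandit's history -/

/-- A history together with the posterior mean and a square root of the posterior covariance. -/
abbrev FilterState (d t : ℕ) : Type := History d t × Vec d × (Vec d →L[ℝ] Vec d)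

variable {t : ℕ}

/-- The parameter and the history, from the filter state and a standard Gaussian vector. -/
def reconstruct (p : FilterState d t × Vec d) : Vec d × History d t :=
  (p.1.2.1 + p.1.2.2 p.2, p.1.1)

/-- The square-root Kalman update of the posterior mean and covariance, for the action `a` and the
normalized innovation `ξ`. -/
def posteriorUpdate (σ : ℝ≥0) (x : Vec d × (Vec d →L[ℝ] Vec d)) (a : Vec d) (ξ : ℝ) :
    Vec d × (Vec d →L[ℝ] Vec d) :=
  (x.1 + (ξ / rewardStd σ (x.2.adjoint a)) • x.2 (x.2.adjoint a),
    x.2 ∘L shrink σ (x.2.adjoint a))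

/-- The filter state after one round, as a function of the state, the action and the normalized
innovation. -/
def filterStep (σ : ℝ≥0) (p : (FilterState d t × Vec d) × ℝ) : FilterState d (t + 1) :=
  (extend p.1.1.1 p.1.2
      (inner ℝ p.1.1.2.1 p.1.2 + rewardStd σ (p.1.1.2.2.adjoint p.1.2) * p.2),
    posteriorUpdate σ p.1.1.2 p.1.2 p.2)

lemma measurable_extend :
    Measurable fun p : History d t × Vec d × ℝ => extend p.1 p.2.1 p.2.2 := by
  unfold extend
  refine measurable_pi_iff.2 fun i => ?_
  refine Fin.lastCases ?_ (fun j => ?_) i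
  · simp only [Fin.snoc_last]
    fun_prop
  · simp only [Fin.snoc_castSucc]
    fun_prop

@[fun_prop]
lemma _root_.Measurable.banditExtend {Ω : Type*} [MeasurableSpace Ω] {h : Ω → History d t}
    {a : Ω → Vec d} {ρ : Ω → ℝ} (hh : Measurable h) (ha : Measurable a) (hρ : Measurable ρ) :
    Measurable fun ω => extend (h ω) (a ω) (ρ ω) :=
  measurable_extend.comp (hh.prodMk (ha.prodMk hρ))

lemma continuous_rewardStd : Continuous (rewardStd (d := d) σ) := by
  unfold rewardStd
  fun_prop

lemma continuous_shrink (hσ : 0 < σ) : Continuous (shrink (d := d) σ) := by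
  have h : Continuous (fun b : Vec d => (innerSL ℝ b).smulRight b) := by
    have : (fun b : Vec d => (innerSL ℝ b).smulRight b) = fun b =>
        ContinuousLinearMap.smulRightL ℝ (Vec d) (Vec d) (innerSL ℝ b) b := rfl
    rw [this]
    fun_prop
  unfold shrink
  refine continuous_const.sub (Continuous.fun_smul ?_ h)
  refine continuous_const.div ?_ fun b => ?_
  · exact continuous_rewardStd.mul (continuous_rewardStd.add continuous_const)
  · have := rewardStd_pos hσ b
    positivity

lemma continuous_adjoint_apply :
    Continuous fun p : (Vec d →L[ℝ] Vec d) × Vec d => p.1.adjoint p.2 :=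
  (ContinuousLinearMap.adjoint.continuous.comp continuous_fst).clm_apply continuous_snd

lemma continuous_posteriorUpdate (hσ : 0 < σ) :
    Continuous fun p : ((Vec d × (Vec d →L[ℝ] Vec d)) × Vec d) × ℝ =>
      posteriorUpdate σ p.1.1 p.1.2 p.2 := by
  have hb : Continuous fun p : ((Vec d × (Vec d →L[ℝ] Vec d)) × Vec d) × ℝ =>
      p.1.1.2.adjoint p.1.2 :=
    continuous_adjoint_apply.comp (f := fun p : ((Vec d × (Vec d →L[ℝ] Vec d)) × Vec d) × ℝ =>
      (p.1.1.2, p.1.2)) (by fun_prop)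
  have hB : Continuous fun p : ((Vec d × (Vec d →L[ℝ] Vec d)) × Vec d) × ℝ => p.1.1.2 := by
    fun_prop
  unfold posteriorUpdate
  refine Continuous.prodMk (Continuous.add (by fun_prop) (Continuous.fun_smul ?_ (hB.clm_apply hb)))
    (hB.clm_comp ((continuous_shrink hσ).comp hb))
  exact continuous_snd.div (continuous_rewardStd.comp hb) fun p => (rewardStd_pos hσ _).ne'

lemma measurable_reconstruct : Measurable (reconstruct (d := d) (t := t)) := by
  have : Measurable fun q : (Vec d × (Vec d →L[ℝ] Vec d)) × Vec d => q.1.1 + q.1.2 q.2 :=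
    (Continuous.add (by fun_prop)
      (Continuous.clm_apply (by fun_prop) (by fun_prop))).measurable
  exact (this.comp (g := fun q : (Vec d × (Vec d →L[ℝ] Vec d)) × Vec d => q.1.1 + q.1.2 q.2)
    (f := fun p : FilterState d t × Vec d => (p.1.2, p.2)) (by fun_prop)).prodMk (by fun_prop)

lemma measurable_filterStep (hσ : 0 < σ) : Measurable (filterStep (d := d) (t := t) σ) := by
  have h1 : Measurable fun p : (FilterState d t × Vec d) × ℝ =>
      rewardStd σ (p.1.1.2.2.adjoint p.1.2) :=
    (continuous_rewardStd.comp continuous_adjoint_apply).measurable.comp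
      (f := fun p : (FilterState d t × Vec d) × ℝ => (p.1.1.2.2, p.1.2)) (by fun_prop)
  have h2 : Measurable fun p : (FilterState d t × Vec d) × ℝ =>
      posteriorUpdate σ p.1.1.2 p.1.2 p.2 :=
    (continuous_posteriorUpdate hσ).measurable.comp
      (f := fun p : (FilterState d t × Vec d) × ℝ => ((p.1.1.2, p.1.2), p.2)) (by fun_prop)
  unfold filterStep
  exact Measurable.prodMk (by fun_prop) h2

/-- `ν` is a law of filter states that represents the law `μ` of the parameter and the history,
with a bound `K` for the square root of the posterior covariance. -/
structure IsFilterLaw (μ : Measure (Vec d × History d t)) (K : ℝ)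
    (ν : Measure (FilterState d t)) : Prop where
  isProbabilityMeasure : IsProbabilityMeasure ν
  map_eq : (ν.prod (stdGaussian (Vec d))).map reconstruct = μ
  lintegral_mean_le :
    ∫⁻ x, ENNReal.ofReal (‖x.2.1‖ ^ 2) ∂ν ≤ ENNReal.ofReal (t * K ^ 2)
  norm_sqrt_cov_le : ∀ᵐ x ∂ν, ‖x.2.2‖ ≤ K

lemma lintegral_law_succ {r : ℝ} (prior : Measure (Vec d)) [IsProbabilityMeasure prior]
    (π : Policy d r) {f : Vec d × History d (t + 1) → ENNReal} (hf : Measurable f) :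
    ∫⁻ x, f x ∂(law prior σ π (t + 1)) =
      ∫⁻ x, ∫⁻ a, ∫⁻ w, f (x.1, extend x.2 a (inner ℝ x.1 a + w)) ∂(gaussianReal 0 (σ ^ 2))
        ∂(π.act t x.2) ∂(law prior σ π t) := by
  have hg : Measurable fun y => f (step d t y) := hf.comp (measurable_step d t)
  rw [law, lintegral_map hf (measurable_step d t), lintegral_prod _ hg.aemeasurable,
    Measure.lintegral_compProd hg.lintegral_prod_right']
  rfl

lemma IsFilterLaw.zero (B : Vec d →L[ℝ] Vec d) {r : ℝ} (π : Policy d r) :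
    IsFilterLaw (law ((stdGaussian (Vec d)).map B) σ π 0) ‖B‖
      (Measure.dirac ((Fin.elim0 : History d 0), (0 : Vec d), B)) where
  isProbabilityMeasure := inferInstance
  map_eq := by
    rw [Measure.dirac_prod, Measure.map_map measurable_reconstruct (by fun_prop), law,
      Measure.map_map (by fun_prop) (by fun_prop)]
    congr 1
    ext1 z
    simp [reconstruct]
  lintegral_mean_le := by
    rw [lintegral_dirac' _ (by fun_prop)]
    simp
  norm_sqrt_cov_le := by
    rw [ae_dirac_iff (measurableSet_le (by fun_prop) (by fun_prop))]

/-- The policy does not see the hidden vector `z`, so after the action is drawn `z` is still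
standard Gaussian. The observation then splits it into an innovation and a fresh independent
Gaussian vector. -/
lemma IsFilterLaw.succ {r : ℝ} {prior : Measure (Vec d)} [IsProbabilityMeasure prior]
    {π : Policy d r} {K : ℝ} {ν : Measure (FilterState d t)} (hσ : 0 < σ)
    (hν : IsFilterLaw (law prior σ π t) K ν) :
    IsFilterLaw (law prior σ π (t + 1)) K
      (((ν ⊗ₘ ((π.act t).comap Prod.fst measurable_fst)).prod (gaussianReal 0 1)).map
        (filterStep σ)) := by
  have := hν.isProbabilityMeasure
  have hstep := measurable_filterStep (d := d) (t := t) hσ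
  have hlin : ∀ {f : FilterState d (t + 1) → ENNReal}, Measurable f →
      ∫⁻ x, f x ∂(((ν ⊗ₘ ((π.act t).comap Prod.fst measurable_fst)).prod
        (gaussianReal 0 1)).map (filterStep σ)) =
      ∫⁻ x, ∫⁻ a, ∫⁻ ξ, f (filterStep σ ((x, a), ξ)) ∂(gaussianReal 0 1) ∂(π.act t x.1) ∂ν := by
    intro f hf
    have hg : Measurable fun y => f (filterStep (d := d) (t := t) σ y) := hf.comp hstep
    rw [lintegral_map hf hstep, lintegral_prod _ hg.aemeasurable,
      Measure.lintegral_compProd hg.lintegral_prod_right']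
    rfl
  refine ⟨Measure.isProbabilityMeasure_map hstep.aemeasurable, ?_, ?_, ?_⟩
  · refine Measure.ext_of_lintegral _ fun f hf => ?_
    have hfr : Measurable fun p => f (reconstruct (d := d) (t := t + 1) p) :=
      hf.comp measurable_reconstruct
    have hinner : Measurable fun y : (Vec d × History d t) × Vec d =>
        ∫⁻ w, f (y.1.1, extend y.1.2 y.2 (inner ℝ y.1.1 y.2 + w)) ∂(gaussianReal 0 (σ ^ 2)) :=
      (hf.comp (measurable_step d t)).lintegral_prod_right'
    have hF : Measurable fun x : Vec d × History d t =>
        ∫⁻ a, ∫⁻ w, f (x.1, extend x.2 a (inner ℝ x.1 a + w)) ∂(gaussianReal 0 (σ ^ 2))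
          ∂(π.act t x.2) :=
      hinner.lintegral_kernel_prod_right' (κ := (π.act t).comap Prod.snd measurable_snd)
    rw [lintegral_law_succ prior π hf, lintegral_map hf measurable_reconstruct,
      lintegral_prod _ hfr.aemeasurable, hlin hfr.lintegral_prod_right', ← hν.map_eq,
      lintegral_map hF measurable_reconstruct,
      lintegral_prod _ (by exact (hF.comp measurable_reconstruct).aemeasurable)]
    refine lintegral_congr fun x => ?_
    obtain ⟨h, m, B⟩ := x
    simp only [reconstruct]
    symm
    -- The swap of `z` and `a` is legitimate because the law of the action depends on `h` alone.
    rw [lintegral_lintegral_swap]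
    · refine lintegral_congr fun a => ?_
      -- The reward is `⟪m, a⟫ + (⟪B† a, z⟫ + w)`, a noisy observation of `z` in the direction `b =
      -- B† a`.
      have hobs := lintegral_stdGaussian_observation hσ (B.adjoint a)
        (f := fun q : Vec d × ℝ => f (m + B q.1, extend h a (inner ℝ m a + q.2)))
        (hf.comp (by fun_prop))
      simp only [ContinuousLinearMap.adjoint_inner_left] at hobs
      simp only [filterStep, posteriorUpdate]
      simp only [inner_add_left, add_assoc, real_inner_comm a (B _)]
      simpa only [map_add, map_smul, ContinuousLinearMap.comp_apply] using hobs
    · exact (hinner.comp (f := fun q : Vec d × Vec d => ((m + B q.1, h), q.2))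
        (by fun_prop)).aemeasurable
  · rw [hlin (by fun_prop)]
    calc _ ≤ ∫⁻ x, (ENNReal.ofReal (‖x.2.1‖ ^ 2) + ENNReal.ofReal (K ^ 2)) ∂ν := by
          refine lintegral_mono_ae ?_
          filter_upwards [hν.norm_sqrt_cov_le] with x hx
          calc _ ≤ ∫⁻ a, (ENNReal.ofReal (‖x.2.1‖ ^ 2) + ENNReal.ofReal (K ^ 2))
                ∂(π.act t x.1) := by
                refine lintegral_mono fun a => ?_
                obtain ⟨h, m, B⟩ := x
                simp only [filterStep, posteriorUpdate]
                set b := B.adjoint a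
                have hρ := rewardStd_pos hσ b
                have hsq := sq_rewardStd (σ := σ) b
                have e : ∀ ξ : ℝ, m + (ξ / rewardStd σ b) • B b =
                    m + ξ • ((1 / rewardStd σ b) • B b) := by
                  intro ξ; rw [smul_smul, mul_one_div]
                simp_rw [e]
                rw [lintegral_norm_add_smul_sq, ← ENNReal.ofReal_add (by positivity) (by positivity)]
                refine ENNReal.ofReal_le_ofReal ?_
                gcongr
                rw [norm_smul, Real.norm_of_nonneg (by positivity)]
                -- The mean moves by `ξ • (B b / ρ)`, and `‖b‖ ≤ ρ` bounds this direction by `‖B‖ ≤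
                -- K` uniformly in the action and in `σ`.
                calc 1 / rewardStd σ b * ‖B b‖ ≤ 1 / rewardStd σ b * (K * rewardStd σ b) := by
                      gcongr
                      refine (B.le_opNorm b).trans ?_
                      gcongr
                      · exact (norm_nonneg _).trans hx
                      · refine le_of_sq_le_sq ?_ hρ.le
                        rw [hsq]
                        nlinarith [sq_nonneg (σ : ℝ)]
                  _ = K := by field_simp
            _ = _ := by simp
      _ = ∫⁻ x, ENNReal.ofReal (‖x.2.1‖ ^ 2) ∂ν + ENNReal.ofReal (K ^ 2) := by
          rw [lintegral_add_right _ measurable_const]; simp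
      _ ≤ ENNReal.ofReal (t * K ^ 2) + ENNReal.ofReal (K ^ 2) := by
          gcongr
          exact hν.lintegral_mean_le
      _ = _ := by
          rw [← ENNReal.ofReal_add (by positivity) (by positivity)]
          push_cast
          ring_nf
  · have hset : MeasurableSet {x : FilterState d t | ‖x.2.2‖ ≤ K} :=
      measurableSet_le (by fun_prop) (by fun_prop)
    rw [ae_map_iff hstep.aemeasurable (measurableSet_le (by fun_prop) (by fun_prop))]
    have h1 := Measure.ae_compProd_of_ae_fst ((π.act t).comap Prod.fst measurable_fst) hset
      hν.norm_sqrt_cov_le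
    have h2 := Measure.quasiMeasurePreserving_fst
      (μ := ν ⊗ₘ ((π.act t).comap Prod.fst measurable_fst)) (ν := gaussianReal 0 1) |>.ae h1
    filter_upwards [h2] with p hp
    refine (ContinuousLinearMap.opNorm_comp_le _ _).trans ?_
    calc _ ≤ K * 1 := by
          exact mul_le_mul hp (norm_shrink_le hσ _) (norm_nonneg _) ((norm_nonneg _).trans hp)
      _ = K := mul_one K

lemma exists_isFilterLaw (hσ : 0 < σ) (B : Vec d →L[ℝ] Vec d) {r : ℝ} (π : Policy d r) (t : ℕ) :
    ∃ ν, IsFilterLaw (law ((stdGaussian (Vec d)).map B) σ π t) ‖B‖ ν := by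
  have : IsProbabilityMeasure ((stdGaussian (Vec d)).map B) :=
    Measure.isProbabilityMeasure_map (by fun_prop)
  induction t with
  | zero => exact ⟨_, IsFilterLaw.zero B π⟩
  | succ t ih =>
    obtain ⟨ν, hν⟩ := ih
    exact ⟨_, hν.succ hσ⟩

/-! ### Integrability and the expected regret of one round -/

variable {r : ℝ}

lemma IsOptimalAction.inner_eq {aStar : Vec d → Vec d} (h : IsOptimalAction r aStar) (hr : 0 ≤ r)
    (θ : Vec d) : inner ℝ θ (aStar θ) = r * ‖θ‖ := by
  obtain ⟨h1, h2⟩ := h θ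
  refine le_antisymm ?_ ?_
  · refine (real_inner_le_norm _ _).trans ?_
    rw [mul_comm]
    exact mul_le_mul_of_nonneg_right h1 (norm_nonneg _)
  · rcases eq_or_ne θ 0 with rfl | hθ
    · simp
    · have hn : 0 < ‖θ‖ := norm_pos_iff.2 hθ
      -- The action pointing along `θ` attains the Cauchy–Schwarz bound.
      have h3 := h2 ((r / ‖θ‖) • θ) (by
        rw [actionSet, Set.mem_ofPred_eq, norm_smul, Real.norm_of_nonneg (by positivity)]
        field_simp
        rfl)
      rw [inner_smul_right, real_inner_self_eq_norm_sq] at h3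
      refine le_of_eq_of_le ?_ h3
      field_simp

lemma map_fst_law (prior : Measure (Vec d)) [IsProbabilityMeasure prior] (π : Policy d r) (t : ℕ) :
    (law prior σ π t).map Prod.fst = prior := by
  induction t with
  | zero =>
    rw [law, Measure.map_map (by fun_prop) (by fun_prop)]
    exact Measure.map_id
  | succ t ih =>
    refine Measure.ext_of_lintegral _ fun f hf => ?_
    rw [lintegral_map hf measurable_fst,
      lintegral_law_succ prior π (f := fun x => f x.1) (by fun_prop)]
    simp only [lintegral_const, measure_univ, mul_one]
    rw [← lintegral_map (f := f) hf measurable_fst, ih]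

/-- The joint law of the parameter, the history and the next action. -/
def actionLaw (prior : Measure (Vec d)) (σ : ℝ≥0) (π : Policy d r) (t : ℕ) :
    Measure ((Vec d × History d t) × Vec d) :=
  law prior σ π t ⊗ₘ (π.act t).comap Prod.snd measurable_snd

instance (prior : Measure (Vec d)) [IsProbabilityMeasure prior] (π : Policy d r) (t : ℕ) :
    IsProbabilityMeasure (actionLaw prior σ π t) := by
  unfold actionLaw
  infer_instance

lemma map_parameter_actionLaw (prior : Measure (Vec d)) [IsProbabilityMeasure prior]
    (π : Policy d r) (t : ℕ) : (actionLaw prior σ π t).map (fun p => p.1.1) = prior := by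
  have h : (actionLaw prior σ π t).map Prod.fst = law prior σ π t := Measure.fst_compProd _ _
  calc (actionLaw prior σ π t).map (fun p => p.1.1)
      = ((actionLaw prior σ π t).map Prod.fst).map Prod.fst :=
        (Measure.map_map measurable_fst measurable_fst).symm
    _ = prior := by rw [h, map_fst_law]

lemma ae_norm_action_le (prior : Measure (Vec d)) [IsProbabilityMeasure prior]
    (π : Policy d r) (t : ℕ) : ∀ᵐ p ∂(actionLaw prior σ π t), ‖p.2‖ ≤ r :=
  Measure.ae_compProd_of_ae_ae (measurableSet_le (by fun_prop) (by fun_prop))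
    (ae_of_all _ fun x => π.mem_actionSet t x.2)

variable {prior : Measure (Vec d)} [IsProbabilityMeasure prior]

lemma integrable_norm_parameter (hp : Integrable (fun θ : Vec d => ‖θ‖) prior)
    (π : Policy d r) (t : ℕ) : Integrable (fun p => ‖p.1.1‖) (actionLaw prior σ π t) := by
  rw [← map_parameter_actionLaw (σ := σ) prior π t] at hp
  exact hp.comp_measurable (by fun_prop)

lemma integral_norm_parameter (π : Policy d r) (t : ℕ) :
    ∫ p, ‖p.1.1‖ ∂(actionLaw prior σ π t) = ∫ θ, ‖θ‖ ∂prior := by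
  conv_rhs => rw [← map_parameter_actionLaw (σ := σ) prior π t]
  rw [integral_map (by fun_prop) (by fun_prop)]

lemma ae_abs_inner_action_le (π : Policy d r) (t : ℕ) :
    ∀ᵐ p ∂(actionLaw prior σ π t), |inner ℝ p.1.1 p.2| ≤ r * ‖p.1.1‖ := by
  filter_upwards [ae_norm_action_le (σ := σ) prior π t] with p hp
  refine (abs_real_inner_le_norm _ _).trans ?_
  rw [mul_comm]
  exact mul_le_mul_of_nonneg_right hp (norm_nonneg _)

lemma integrable_inner_action (hp : Integrable (fun θ : Vec d => ‖θ‖) prior)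
    (π : Policy d r) (t : ℕ) :
    Integrable (fun p => (inner ℝ p.1.1 p.2 : ℝ)) (actionLaw prior σ π t) :=
  ((integrable_norm_parameter hp π t).const_mul r).mono' (by fun_prop)
    (ae_abs_inner_action_le π t)

section regret

variable {aStar : Vec d → Vec d}

lemma instRegret_step (h : IsOptimalAction r aStar) (hr : 0 ≤ r)
    (q : ((Vec d × History d t) × Vec d) × ℝ) :
    instRegret aStar t (step d t q) = r * ‖q.1.1.1‖ - inner ℝ q.1.1.1 q.1.2 - q.2 := by
  simp [instRegret, step, extend, h.inner_eq hr, sub_sub]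

lemma measurable_instRegret (h : IsOptimalAction r aStar) (hr : 0 ≤ r) :
    Measurable (instRegret aStar t) := by
  unfold instRegret
  simp_rw [h.inner_eq hr]
  fun_prop

lemma integrable_instRegret_step (h : IsOptimalAction r aStar) (hr : 0 ≤ r)
    (hp : Integrable (fun θ : Vec d => ‖θ‖) prior) (π : Policy d r) :
    Integrable (fun q => instRegret aStar t (step d t q))
      ((actionLaw prior σ π t).prod (gaussianReal 0 (σ ^ 2))) := by
  simp_rw [instRegret_step h hr]
  have hw : Integrable (fun w : ℝ => w) (gaussianReal 0 (σ ^ 2)) := IsGaussian.integrable_fun_id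
  exact ((((integrable_norm_parameter hp π t).const_mul r).sub
    (integrable_inner_action hp π t)).comp_fst _).sub (hw.comp_snd _)

lemma integrable_instRegret (h : IsOptimalAction r aStar) (hr : 0 ≤ r)
    (hp : Integrable (fun θ : Vec d => ‖θ‖) prior) (π : Policy d r) :
    Integrable (instRegret aStar t) (law prior σ π (t + 1)) :=
  (integrable_map_measure (measurable_instRegret h hr).aestronglyMeasurable
    (measurable_step d t).aemeasurable).2 (integrable_instRegret_step h hr hp π)

lemma integral_instRegret (h : IsOptimalAction r aStar) (hr : 0 ≤ r)
    (hp : Integrable (fun θ : Vec d => ‖θ‖) prior) (π : Policy d r) :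
    ∫ x, instRegret aStar t x ∂(law prior σ π (t + 1)) =
      r * ∫ θ, ‖θ‖ ∂prior - ∫ p, inner ℝ p.1.1 p.2 ∂(actionLaw prior σ π t) := by
  have hN := (integrable_norm_parameter (σ := σ) hp π t).const_mul r
  have hI := integrable_inner_action (σ := σ) hp π t
  have hw : Integrable (fun w : ℝ => w) (gaussianReal 0 (σ ^ 2)) := IsGaussian.integrable_fun_id
  have h0 : ∫ w, w ∂(gaussianReal 0 (σ ^ 2)) = 0 := integral_id_gaussianReal
  have hint := integrable_instRegret_step (σ := σ) (t := t) h hr hp π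
  rw [law, integral_map (measurable_step d t).aemeasurable
    (measurable_instRegret h hr).aestronglyMeasurable]
  change ∫ q, instRegret aStar t (step d t q)
    ∂((actionLaw prior σ π t).prod (gaussianReal 0 (σ ^ 2))) = _
  rw [integral_prod _ hint]
  simp_rw [instRegret_step h hr]
  simp_rw [integral_sub (integrable_const _) hw, h0, integral_const]
  simp only [probReal_univ, one_smul, sub_zero]
  rw [integral_sub hN hI, integral_const_mul, integral_norm_parameter]

lemma integral_instRegret_nonneg (h : IsOptimalAction r aStar) (hr : 0 ≤ r)
    (hp : Integrable (fun θ : Vec d => ‖θ‖) prior) (π : Policy d r) :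
    0 ≤ ∫ x, instRegret aStar t x ∂(law prior σ π (t + 1)) := by
  rw [integral_instRegret h hr hp, ← integral_norm_parameter (σ := σ) π t, ← integral_const_mul,
    sub_nonneg]
  refine integral_mono_ae (integrable_inner_action hp π t)
    ((integrable_norm_parameter hp π t).const_mul r) ?_
  filter_upwards [ae_abs_inner_action_le (σ := σ) (prior := prior) π t] with p h
  exact (le_abs_self _).trans h

end regret

/-! ### Bounding the expected reward by the size of the posterior mean -/

lemma IsFilterLaw.memLp_mean {μ : Measure (Vec d × History d t)} {K : ℝ}
    {ν : Measure (FilterState d t)} (hν : IsFilterLaw μ K ν) :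
    MemLp (fun x => ‖x.2.1‖) 2 ν := by
  refine (memLp_two_iff_integrable_sq (by fun_prop)).2 ⟨by fun_prop, ?_⟩
  rw [hasFiniteIntegral_iff_ofReal (ae_of_all _ fun _ => sq_nonneg _)]
  exact hν.lintegral_mean_le.trans_lt ENNReal.ofReal_lt_top

lemma IsFilterLaw.integral_norm_mean_le {μ : Measure (Vec d × History d t)} {K : ℝ}
    {ν : Measure (FilterState d t)} (hν : IsFilterLaw μ K ν) (hK : 0 ≤ K) :
    ∫ x, ‖x.2.1‖ ∂ν ≤ √t * K := by
  have := hν.isProbabilityMeasure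
  have h1 : ∫ x, ‖x.2.1‖ ^ 2 ∂ν ≤ t * K ^ 2 := by
    rw [integral_eq_lintegral_of_nonneg_ae (ae_of_all _ fun _ => sq_nonneg _) (by fun_prop)]
    exact ENNReal.toReal_le_of_le_ofReal (by positivity) hν.lintegral_mean_le
  -- Nonnegative variance serves as Jensen's inequality `(E‖m‖)² ≤ E‖m‖²`.
  have h2 := variance_nonneg (fun x : FilterState d t => ‖x.2.1‖) ν
  rw [variance_eq_sub hν.memLp_mean] at h2
  refine le_of_sq_le_sq ?_ (by positivity)
  rw [mul_pow, Real.sq_sqrt (Nat.cast_nonneg t)]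
  simp only [Pi.pow_apply] at h2
  linarith

lemma norm_integral_act_le (π : Policy d r) (h : History d t) : ‖∫ a, a ∂(π.act t h)‖ ≤ r := by
  refine (norm_integral_le_of_norm_le_const (π.mem_actionSet t h)).trans_eq ?_
  simp

lemma integrable_act (π : Policy d r) (h : History d t) :
    Integrable (fun a => a) (π.act t h) :=
  Integrable.of_bound (by fun_prop) r (π.mem_actionSet t h)

/-- Averaging over the action given the history, and then over the centred vector `z`, leaves `⟪m,
ā⟫`, where the mean action `ā` has norm at most `r`. -/
lemma integral_inner_action_le (hp : Integrable (fun θ : Vec d => ‖θ‖) prior) (π : Policy d r)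
    (hr : 0 ≤ r) {K : ℝ} (hK : 0 ≤ K) {ν : Measure (FilterState d t)}
    (hν : IsFilterLaw (law prior σ π t) K ν) :
    ∫ p, inner ℝ p.1.1 p.2 ∂(actionLaw prior σ π t) ≤ r * (√t * K) := by
  have := hν.isProbabilityMeasure
  have hI := integrable_inner_action (σ := σ) hp π t
  have hz : Integrable (fun z : Vec d => z) (stdGaussian (Vec d)) := IsGaussian.integrable_fun_id
  have e1 : ∀ x : Vec d × History d t,
      ∫ a, inner ℝ x.1 a ∂(π.act t x.2) = (inner ℝ x.1 (∫ a, a ∂(π.act t x.2)) : ℝ) := fun x =>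
    integral_inner (integrable_act π x.2) x.1
  have hJ : Integrable (fun x : Vec d × History d t =>
      (inner ℝ x.1 (∫ a, a ∂(π.act t x.2)) : ℝ)) (law prior σ π t) := by
    have h : Integrable (fun x : Vec d × History d t => ∫ a, (inner ℝ x.1 a : ℝ) ∂(π.act t x.2))
        (law prior σ π t) :=
      Integrable.integral_compProd (κ := Kernel.const Unit (law prior σ π t))
        (η := Kernel.prodMkLeft Unit ((π.act t).comap Prod.snd measurable_snd)) (a := ()) hI
    simpa only [e1] using h
  rw [actionLaw, Measure.integral_compProd hI]
  simp_rw [Kernel.comap_apply, e1]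
  rw [← hν.map_eq] at hJ ⊢
  have hJ' : Integrable (fun p : FilterState d t × Vec d =>
      (inner ℝ (reconstruct p).1 (∫ a, a ∂(π.act t (reconstruct p).2)) : ℝ))
      (ν.prod (stdGaussian (Vec d))) := hJ.comp_measurable measurable_reconstruct
  rw [integral_map measurable_reconstruct.aemeasurable hJ.aestronglyMeasurable]
  have e2 : ∀ x : FilterState d t,
      ∫ z, inner ℝ (x.2.1 + x.2.2 z) (∫ a, a ∂(π.act t x.1)) ∂(stdGaussian (Vec d)) =
        (inner ℝ x.2.1 (∫ a, a ∂(π.act t x.1)) : ℝ) := by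
    intro x
    have hB : Integrable (fun z => x.2.2 z) (stdGaussian (Vec d)) := x.2.2.integrable_comp hz
    simp_rw [real_inner_comm (∫ a, a ∂(π.act t x.1))]
    rw [integral_inner (f := fun z => x.2.1 + x.2.2 z) ((integrable_const _).add hB),
      integral_add (integrable_const _) hB,
      ContinuousLinearMap.integral_comp_comm _ hz, integral_id_stdGaussian]
    simp
  have hJ2 := hJ'.integral_prod_left
  rw [integral_prod _ hJ']
  simp only [reconstruct] at hJ2 ⊢
  simp_rw [e2] at hJ2 ⊢
  have hm : Integrable (fun x : FilterState d t => ‖x.2.1‖) ν :=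
    hν.memLp_mean.integrable one_le_two
  calc _ ≤ ∫ x : FilterState d t, r * ‖x.2.1‖ ∂ν := by
        refine integral_mono hJ2 (hm.const_mul r) fun x => ?_
        refine (real_inner_le_norm _ _).trans ?_
        rw [mul_comm]
        exact mul_le_mul_of_nonneg_right (norm_integral_act_le π x.1) (norm_nonneg _)
    _ ≤ _ := by
        rw [integral_const_mul]
        exact mul_le_mul_of_nonneg_left (hν.integral_norm_mean_le hK) hr

open scoped MatrixOrder in
lemma multivariateGaussian_zero_eq_map (S : Matrix (Fin d) (Fin d) ℝ) :
    multivariateGaussian 0 S =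
      (stdGaussian (Vec d)).map (Matrix.toEuclideanCLM (n := Fin d) (𝕜 := ℝ) (CFC.sqrt S)) := by
  simp [multivariateGaussian]

open scoped MatrixOrder in
/-- A single round has regret at least the expected norm of the parameter minus what `t` linear
observations can reveal about it. -/
lemma le_integral_instRegret {S : Matrix (Fin d) (Fin d) ℝ} (hS : S.PosSemidef) {L : ℝ}
    (hL : ∀ i, hS.isHermitian.eigenvalues i ≤ L) (hL0 : 0 ≤ L) {aStar : Vec d → Vec d}
    (h : IsOptimalAction r aStar) (hr : 0 ≤ r) (hσ : 0 < σ) (π : Policy d r) :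
    r * (absMean * √S.trace - √(t * L)) ≤
      ∫ x, instRegret aStar t x ∂(law (multivariateGaussian 0 S) σ π (t + 1)) := by
  have hp : Integrable (fun θ : Vec d => ‖θ‖) (multivariateGaussian 0 S) :=
    IsGaussian.integrable_fun_id.norm
  obtain ⟨ν, hν⟩ := exists_isFilterLaw hσ
    (Matrix.toEuclideanCLM (n := Fin d) (𝕜 := ℝ) (CFC.sqrt S)) π t
  rw [← multivariateGaussian_zero_eq_map] at hν
  have h1 := integral_inner_action_le hp π hr (norm_nonneg _) hν
  have h2 := norm_toEuclideanCLM_sqrt_le hS hL hL0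
  have h3 : √(t : ℝ) * ‖Matrix.toEuclideanCLM (n := Fin d) (𝕜 := ℝ) (CFC.sqrt S)‖ ≤ √(t * L) := by
    rw [Real.sqrt_mul (Nat.cast_nonneg t)]
    gcongr
  have h4 := absMean_mul_sqrt_trace_le hS
  rw [integral_instRegret h hr hp, mul_sub]
  have h5 := mul_le_mul_of_nonneg_left h3 hr
  have h6 := mul_le_mul_of_nonneg_left h4 hr
  linarith

/-! ### Comparing the top eigenvalue with the trace under polynomial scaling -/

section eigenvalues

variable {S : Matrix (Fin d) (Fin d) ℝ} {hS : S.IsHermitian} {α : ℝ} {s : ℕ}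

lemma PolynomialEigenvalues.eigenvalues_le (h : PolynomialEigenvalues hS α s) (hα : 0 ≤ α)
    (i : Fin d) : hS.eigenvalues i ≤ ((d - 1 + s : ℕ) : ℝ) ^ (2 * α) := by
  set j := (Fintype.equivOfCardEq (Fintype.card_fin (Fintype.card (Fin d)))).symm i
  have hj := h j.rev
  rw [Fin.rev_rev] at hj
  have hlt : (j.rev : ℕ) < d := by simpa using j.rev.2
  change hS.eigenvalues₀ j ≤ _
  rw [hj]
  refine Real.rpow_le_rpow (Nat.cast_nonneg _) (Nat.cast_le.2 ?_) (by positivity)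
  omega

/-- Pairing each eigenvalue with its mirror image counts the trace twice, and the larger member of
each pair has base at least half the top one. This yields the factor `2 * 2 ^ (2 * α)`. -/
lemma PolynomialEigenvalues.mul_le_trace (h : PolynomialEigenvalues hS α s) (hα : 0 ≤ α) :
    d * ((d - 1 + s : ℕ) : ℝ) ^ (2 * α) ≤ 2 * 2 ^ (2 * α) * S.trace := by
  have htr : S.trace = ∑ i, hS.eigenvalues₀ i := by
    rw [hS.trace_eq_sum_eigenvalues]
    exact Equiv.sum_comp
      (Fintype.equivOfCardEq (Fintype.card_fin (Fintype.card (Fin d)))).symm hS.eigenvalues₀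
  have hrev : S.trace = ∑ i : Fin (Fintype.card (Fin d)), hS.eigenvalues₀ i.rev := by
    rw [htr]
    exact (Equiv.sum_comp Fin.revPerm hS.eigenvalues₀).symm
  have hpair : ∀ i : Fin (Fintype.card (Fin d)), ((d - 1 + s : ℕ) : ℝ) ^ (2 * α) ≤
      2 ^ (2 * α) * (hS.eigenvalues₀ i + hS.eigenvalues₀ i.rev) := by
    intro i
    have h1 := h i
    have h2 := h i.rev
    rw [Fin.rev_rev] at h2
    rw [h1, h2]
    set M := max ((i.rev : ℕ) + s) ((i : ℕ) + s) with hM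
    -- The index and its mirror image add up to `d - 1`, so the two bases sum to `d - 1 + 2 s`.
    have hle : d - 1 + s ≤ 2 * M := by
      have hi := Fin.val_rev i
      have hlt := i.2
      simp only [Fintype.card_fin] at hi hlt
      omega
    calc ((d - 1 + s : ℕ) : ℝ) ^ (2 * α) ≤ ((2 * M : ℕ) : ℝ) ^ (2 * α) :=
          Real.rpow_le_rpow (Nat.cast_nonneg _) (Nat.cast_le.2 hle) (by positivity)
      _ = 2 ^ (2 * α) * (M : ℝ) ^ (2 * α) := by
          push_cast
          exact Real.mul_rpow zero_le_two (by positivity)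
      _ ≤ _ := by
          gcongr
          have p1 : (0 : ℝ) ≤ (((i.rev : ℕ) + s : ℕ) : ℝ) ^ (2 * α) := by positivity
          have p2 : (0 : ℝ) ≤ (((i : ℕ) + s : ℕ) : ℝ) ^ (2 * α) := by positivity
          rcases max_choice ((i.rev : ℕ) + s) ((i : ℕ) + s) with hc | hc <;> rw [hM, hc] <;> linarith
  calc d * ((d - 1 + s : ℕ) : ℝ) ^ (2 * α)
      = ∑ _i : Fin (Fintype.card (Fin d)), ((d - 1 + s : ℕ) : ℝ) ^ (2 * α) := by simp
    _ ≤ ∑ i : Fin (Fintype.card (Fin d)),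
        2 ^ (2 * α) * (hS.eigenvalues₀ i + hS.eigenvalues₀ i.rev) :=
      Finset.sum_le_sum fun i _ => hpair i
    _ = _ := by
      rw [← Finset.mul_sum, Finset.sum_add_distrib, ← hrev, ← htr]
      ring

end eigenvalues

end LinearGaussianBandit

/-! ### Summing over the burn-in rounds -/

open LinearGaussianBandit

theorem mainTheorem7 (α : ℝ) (hα : 0 ≤ α) :
    ∃ c : ℝ, 0 < c ∧
      ∀ (d T : ℕ) (r : ℝ) (σ : ℝ≥0) (S₀ : Matrix (Fin d) (Fin d) ℝ) (hS₀ : S₀.PosSemidef)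
        (s : ℕ) (aStar : LinearGaussianBandit.Vec d → LinearGaussianBandit.Vec d)
        (π : LinearGaussianBandit.Policy d r),
        0 ≤ r → 0 < σ → d ≤ T → (s = 0 ∨ s = 1) →
        LinearGaussianBandit.PolynomialEigenvalues hS₀.isHermitian α s →
        LinearGaussianBandit.IsOptimalAction r aStar →
        (∀ t < T, Integrable (LinearGaussianBandit.instRegret aStar t)
          (LinearGaussianBandit.law (multivariateGaussian 0 S₀) σ π (t + 1))) ∧
        c * (r * d * √(S₀.trace)) ≤
          LinearGaussianBandit.bayesRegret (multivariateGaussian 0 S₀) σ aStar π T := by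
  have hκ := absMean_pos
  set κ := absMean
  -- The second entry makes `ε d L ≤ (κ/2)² tr Σ₀`, so that learning gains back at most half of `κ
  -- √(tr Σ₀)`; the bound by `1` keeps `⌈ε d⌉₊ ≤ d ≤ T`.
  set ε : ℝ := min 1 (κ ^ 2 / (4 * (2 * 2 ^ (2 * α))))
  have hε0 : 0 < ε := lt_min one_pos (by positivity)
  refine ⟨ε * (κ / 2), by positivity, ?_⟩
  intro d T r σ S hS s aStar π hr hσ hT _ hpoly hopt
  have hp : Integrable (fun θ : Vec d => ‖θ‖) (multivariateGaussian 0 S) :=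
    IsGaussian.integrable_fun_id.norm
  refine ⟨fun t _ => integrable_instRegret hopt hr hp π, ?_⟩
  set L : ℝ := ((d - 1 + s : ℕ) : ℝ) ^ (2 * α)
  have hL0 : 0 ≤ L := by positivity
  have hLtr : d * L ≤ 2 * 2 ^ (2 * α) * S.trace := hpoly.mul_le_trace hα
  have htr : 0 ≤ S.trace := by
    refine nonneg_of_mul_nonneg_right ((by positivity : (0 : ℝ) ≤ d * L).trans hLtr) (by positivity)
  have hround : ∀ t < ⌈ε * d⌉₊, r * (κ / 2 * √S.trace) ≤
      ∫ x, instRegret aStar t x ∂(law (multivariateGaussian 0 S) σ π (t + 1)) := by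
    intro t ht
    refine le_trans ?_ (le_integral_instRegret hS (hpoly.eigenvalues_le hα) hL0 hopt hr hσ π)
    -- Rounds are indexed from `0`, so `t < ⌈ε d⌉₊` already means `t < ε d`; rounding up the number
    -- of rounds costs nothing.
    have ht' : (t : ℝ) ≤ ε * d := (Nat.lt_ceil.1 ht).le
    have h1 : √(t * L) ≤ κ / 2 * √S.trace := by
      refine Real.sqrt_le_iff.2 ⟨by positivity, ?_⟩
      rw [mul_pow, Real.sq_sqrt htr]
      calc t * L ≤ ε * d * L := by gcongr
        _ = ε * (d * L) := by ring
        _ ≤ κ ^ 2 / (4 * (2 * 2 ^ (2 * α))) * (2 * 2 ^ (2 * α) * S.trace) := by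
            gcongr
            exact min_le_right _ _
        _ = (κ / 2) ^ 2 * S.trace := by
            field_simp
            ring
    gcongr
    linarith
  have hN : ⌈ε * d⌉₊ ≤ T := by
    refine (Nat.ceil_le.2 ?_).trans hT
    exact mul_le_of_le_one_left (Nat.cast_nonneg d) (min_le_left _ _)
  calc ε * (κ / 2) * (r * d * √S.trace) = ε * d * (r * (κ / 2 * √S.trace)) := by ring
    _ ≤ ⌈ε * d⌉₊ * (r * (κ / 2 * √S.trace)) := by
        gcongr
        exact Nat.le_ceil _
    _ = ∑ t ∈ Finset.range ⌈ε * d⌉₊, r * (κ / 2 * √S.trace) := by simp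
    _ ≤ ∑ t ∈ Finset.range ⌈ε * d⌉₊,
        ∫ x, instRegret aStar t x ∂(law (multivariateGaussian 0 S) σ π (t + 1)) :=
      Finset.sum_le_sum fun t ht => hround t (Finset.mem_range.1 ht)
    _ ≤ _ :=
      Finset.sum_le_sum_of_subset_of_nonneg (Finset.range_mono hN) fun t _ _ =>
        integral_instRegret_nonneg hopt hr hp π

end
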